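/- Let $\mathcal{X},\mathcal{Y}$ be finite sets and let $P_{X,Y}$ be a pmf on $\mathcal{X}\times\mathcal{Y}$ whose marginals satisfy $P_X(x)>0$ for all $x\in\mathcal{X}$ and $P_Y(y)>0$ for all $y\in\mathcal{Y}$. Let $f:(0,\infty)\to\mathbb{R}$ be a convex function with a finite limit $f(0):=\lim_{t\to0^+}f(t)$ such that: (i) $f$ is strictly convex at $1$ (i.e. $\lambda f(x)+(1-\lambda)f(y)>f(1)$ whenever $x\neq y$ in $(0,\infty)$, $\lambda\in(0,1)$ and $\lambda x+(1-\lambda)y=1$) and thrice differentiable at $1$, with $f(1)=0$ and $f''(1)>0$; (ii) for every $t\in(0,\infty)$, $$\left(f(t)-f'(1)(t-1)\right)\left(1-\frac{f'''(1)}{3f''(1)}(t-1)\right)\ge\frac{f''(1)}{2}(t-1)^2;$$ (iii) the function $x\mapsto\frac{f(x)-f(0)}{x}$ is concave on $(0,\infty)$; (iv) the $f$-entropy $\mathrm{Ent}_f(U):=\mathbb{E}[f(U)]-f(\mathbb{E}[U])$ (of nonnegative random variables $U$ with finite range) is sub-additive and homogeneous. Sub-additive means that for all independent $Z_1,\dots,Z_m$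 with finite ranges and all nonnegative functions $U$ of $(Z_1,\dots,Z_m)$, $$\mathrm{Ent}_f(U)\le\sum_{i=1}^m\mathbb{E}\left[\mathrm{Ent}_f\left(U\mid (Z_j)_{j\ne i}\right)\right],$$ where $\mathrm{Ent}_f(U\mid (Z_j)_{j\ne i})$ is the $f$-entropy of $U$ as a function of $Z_i$ with the other variables held fixed. Homogeneous means that there is a function $\kappa:(0,\infty)\to[0,\infty)$ with $\mathrm{Ent}_f(cU)=\kappa(c)\,\mathrm{Ent}_f(U)$ for all $c>0$ and all such $U$. For pmfs $R,P$ on a finite set let $D_f(R\|P)=\sum_x P(x)f\left(R(x)/P(x)\right)$, with the conventions $0f(0/0)=0$ and $0f(r/0)=r\lim_{p\to0^+}pf(1/p)$ for $r>0$. For jointly distributed $X,Y$ with finite ranges, let $W$ be the column stochastic transition matrix of $P_{Y|X}$ and let $$\eta_f(P_X,P_{Y|X})=\sup_{R_X:\,0<D_f(R_X\|P_X)<\infty}\frac{D_f(WR_X\|WP_X)}{D_f(R_X\|P_X)},$$ the supremum being over pmfs $R_X$ on the range of $X$, with $\eta_f(P_X,P_{Y|X})=0$ if $X$ or $Y$ is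 almost surely constant; let $\eta_{\chi^2}$ be this quantity for $t\mapsto t^2-1$ in place of $f$. If $(X_1,Y_1),\dots,(X_n,Y_n)$ are i.i.d. with joint pmf $P_{X,Y}$, and $X_1^n=(X_1,\dots,X_n)$, $Y_1^n=(Y_1,\dots,Y_n)$, then $$\eta_{\chi^2}\left(P_{X_1^n},P_{Y_1^n|X_1^n}\right)\le\eta_f\left(P_{X_1^n},P_{Y_1^n|X_1^n}\right)\le\frac{f'(1)+f(0)}{f''(1)\,\min_{x\in\mathcal{X}}P_X(x)}\;\eta_{\chi^2}\left(P_{X_1^n},P_{Y_1^n|X_1^n}\right).$$ -/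

import Mathlib

open Set Filter Topology Matrix
open scoped BigOperators

noncomputable section

/-!  Throughout, a function `f : (0, ∞) → ℝ` with a finite limit at `0⁺` is represented by a function
`f : ℝ → ℝ` whose value at `0` is that limit; its values on the negative axis are never used.
A pmf on a finite set `A` is an element of `stdSimplex ℝ A`. -/

/-- Strict convexity at unity. -/
def StrictConvexAtOne (f : ℝ → ℝ) : Prop :=
  ∀ x y l : ℝ, 0 < x → 0 < y → x ≠ y → 0 < l → l < 1 → l * x + (1 - l) * y = 1 →
    f 1 < l * f x + (1 - l) * f y

/-- `f` is thrice differentiable at unity: `f` and `f'` are differentiable near `1`, and `f''` is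
differentiable at `1`. -/
def ThriceDifferentiableAtOne (f : ℝ → ℝ) : Prop :=
  (∀ᶠ t in 𝓝 (1 : ℝ), DifferentiableAt ℝ f t) ∧
  (∀ᶠ t in 𝓝 (1 : ℝ), DifferentiableAt ℝ (deriv f) t) ∧
  DifferentiableAt ℝ (deriv (deriv f)) 1

/-- The limit of `p f(1/p)` as `p → 0⁺`, possibly `+∞`. -/
def recession (f : ℝ → ℝ) : EReal :=
  limUnder (𝓝[>] (0 : ℝ)) (fun p : ℝ => ((p * f (1 / p) : ℝ) : EReal))

/-- The summand `p f(r/p)` of the `f`-divergence, with `0 f(0/0) = 0` and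
`0 f(r/0) = r lim_{p → 0⁺} p f(1/p)` for `r > 0`. -/
def fDivTerm (f : ℝ → ℝ) (r p : ℝ) : EReal :=
  if p = 0 then (if r = 0 then 0 else (r : EReal) * recession f)
  else ((p * f (r / p) : ℝ) : EReal)

/-- The `f`-divergence `D_f(R || P)`. -/
def fDiv {A : Type*} [Fintype A] (f : ℝ → ℝ) (R P : A → ℝ) : EReal :=
  ∑ a, fDivTerm f (R a) (P a)

open Classical in
/-- The contraction coefficient `η_f(P_X, P_{Y|X})` for the input pmf `P` and the channel with column
stochastic transition matrix `W`. It is `0` by convention if `X` or `Y` is almost surely constant. -/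
def contractionCoeff {A B : Type*} [Fintype A] [Fintype B] (f : ℝ → ℝ) (P : A → ℝ)
    (W : Matrix B A ℝ) : EReal :=
  if (∃ x, P x = 1) ∨ (∃ y, (W *ᵥ P) y = 1) then 0
  else ⨆ R ∈ {R : A → ℝ | R ∈ stdSimplex ℝ A ∧ 0 < fDiv f R P ∧ fDiv f R P < ⊤},
    fDiv f (W *ᵥ R) (W *ᵥ P) / fDiv f R P

/-- The function `t ↦ t² - 1`, which defines the `χ²`-divergence. -/
def chiSqFun : ℝ → ℝ := fun t => t ^ 2 - 1

/-- The marginal pmf of the first component of a joint pmf. -/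
def marginalX {A B : Type*} [Fintype B] (Q : A × B → ℝ) : A → ℝ := fun x => ∑ y, Q (x, y)

/-- The marginal pmf of the second component of a joint pmf. -/
def marginalY {A B : Type*} [Fintype A] (Q : A × B → ℝ) : B → ℝ := fun y => ∑ x, Q (x, y)

/-- The transition matrix of the conditional pmfs `P_{Y|X=x}` of a joint pmf (with `P_X > 0`). -/
def condChannel {A B : Type*} [Fintype B] (Q : A × B → ℝ) : Matrix B A ℝ :=
  Matrix.of fun y x => Q (x, y) / marginalX Q x

/-- The contraction coefficient `η_f(P_X, P_{Y|X})` of a pair `(X, Y)` with joint pmf `Q`. -/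
def eta {A B : Type*} [Fintype A] [Fintype B] (f : ℝ → ℝ) (Q : A × B → ℝ) : EReal :=
  contractionCoeff f (marginalX Q) (condChannel Q)

/-- The joint pmf of `(X₁ⁿ, Y₁ⁿ)` for pairs `(X₁, Y₁), …, (Xₙ, Yₙ)` that are i.i.d. with joint
pmf `Q`. -/
def iidJoint {A B : Type*} (Q : A × B → ℝ) (n : ℕ) : (Fin n → A) × (Fin n → B) → ℝ :=
  fun z => ∏ i, Q (z.1 i, z.2 i)

/-- The `f`-entropy `E[f(U)] - f(E[U])` of a nonnegative function `U` of a random variable with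
pmf `Q` on a finite set. -/
def fEntropy {A : Type*} [Fintype A] (f : ℝ → ℝ) (Q U : A → ℝ) : ℝ :=
  ∑ a, Q a * f (U a) - f (∑ a, Q a * U a)

/-- Sub-additivity of the `f`-entropy: for independent `Z₁, …, Zₘ` with finite ranges and every
nonnegative function `U` of them,
`Ent_f(U) ≤ ∑ᵢ E[Ent_f(U | Z₁, …, Zᵢ₋₁, Zᵢ₊₁, …, Zₘ)]`. -/
def SubadditiveEntropy (f : ℝ → ℝ) : Prop :=
  ∀ (m : ℕ) (k : Fin m → ℕ) (Q : ∀ i, Fin (k i) → ℝ) (U : (∀ i, Fin (k i)) → ℝ),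
    (∀ i, Q i ∈ stdSimplex ℝ (Fin (k i))) → (∀ z, 0 ≤ U z) →
    fEntropy f (fun z => ∏ i, Q i (z i)) U ≤
      ∑ i, ∑ z, (∏ j, Q j (z j)) * fEntropy f (Q i) (fun a => U (Function.update z i a))

/-- Homogeneity of the `f`-entropy: `Ent_f(c U) = κ(c) Ent_f(U)` for all `c > 0` and all nonnegative
`U`, for some function `κ`. -/
def HomogeneousEntropy (f : ℝ → ℝ) : Prop :=
  ∃ κ : ℝ → ℝ, ∀ c : ℝ, 0 < c → 0 ≤ κ c ∧
    ∀ (k : ℕ) (Q U : Fin k → ℝ), Q ∈ stdSimplex ℝ (Fin k) → (∀ a, 0 ≤ U a) →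
      fEntropy f Q (fun a => c * U a) = κ c * fEntropy f Q U

end

/-! ### The `f`-entropy -/

/-! Since the input pmf is positive, every input is a density `U` times it. The `f`-divergence is
then the `f`-entropy of `U`, and the channel replaces `U` by `condMean Q U`, so contraction
coefficients compare entropies.

Lower bound: along `1 + ε (U - 1)` the entropy is `ε² f''(1)/2` times the `χ²`-entropy of `U`, up to
`o(ε²)`. The perturbation commutes with conditional expectation, so ratios of `f`-entropies tend to
ratios of `χ²`-entropies (`eta_chiSqFun_le_eta`).

Upper bound: on densities, with `m` the minimum of the input pmf, `f''(1) m χ² ≤ Ent_f ≤ (f'(1) +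
f(0)) χ²` (`chiSq_le_fEntropy`, `fEntropy_le_chiSq`). For `n` copies this would bring in `mⁿ`, so
the sandwich is applied to a single pair. If `K` is the `χ²` coefficient of the `n` copies, testing
on functions of the first coordinate shows that `K` bounds one pair too
(`fEntropy_chiSqFun_condMean_le`). Hence one pair contracts the `f`-entropy with constant `(f'(1) +
f(0)) K / (f''(1) m)`. Homogeneity extends this from densities to all nonnegative `U`, and
sub-additivity tensorizes it with the same constant (`EntropyContracts.prod`). -/

theorem fEntropy_comp_equiv {A B : Type*} [Fintype A] [Fintype B] (f : ℝ → ℝ) (e : A ≃ B)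
    (Q U : B → ℝ) : fEntropy f (fun a => Q (e a)) (fun a => U (e a)) = fEntropy f Q U := by
  unfold fEntropy
  rw [e.sum_comp (fun b => Q b * f (U b)), e.sum_comp (fun b => Q b * U b)]

/-- The chain rule for the `f`-entropy, conditioning on the second coordinate. -/
theorem fEntropy_prod_right {A B : Type*} [Fintype A] [Fintype B] (f : ℝ → ℝ)
    (w : A → ℝ) (P : B → ℝ) (U : A → B → ℝ) :
    fEntropy f (fun z : A × B => w z.1 * P z.2) (fun z => U z.1 z.2) =
      ∑ b, P b * fEntropy f w (fun a => U a b) + fEntropy f P (fun b => ∑ a, w a * U a b) := by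
  unfold fEntropy
  simp only [Fintype.sum_prod_type_right, mul_sub, Finset.sum_sub_distrib, Finset.mul_sum]
  have h1 : ∀ b a, w a * P b * f (U a b) = P b * (w a * f (U a b)) := fun b a => by ring
  have h2 : ∀ b a, w a * P b * U a b = P b * (w a * U a b) := fun b a => by ring
  simp only [h1, h2]
  ring

/-- The chain rule for the `f`-entropy, conditioning on the first coordinate. -/
theorem fEntropy_prod_left {A B : Type*} [Fintype A] [Fintype B] (f : ℝ → ℝ)
    (w : A → ℝ) (P : B → ℝ) (U : A → B → ℝ) :
    fEntropy f (fun z : A × B => w z.1 * P z.2) (fun z => U z.1 z.2) =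
      ∑ a, w a * fEntropy f P (U a) + fEntropy f w (fun a => ∑ b, P b * U a b) := by
  rw [← fEntropy_prod_right f P w (fun b a => U a b), ← fEntropy_comp_equiv f (Equiv.prodComm A B)]
  simp [mul_comm]

/-- The case of two variables. The sizes form one function `k` so that `Fin (k i)` matches the
dependent family in the hypothesis by definition. -/
theorem SubadditiveEntropy.fEntropy_pair_le {f : ℝ → ℝ} (hsub : SubadditiveEntropy f)
    (k : Fin 2 → ℕ) (w : Fin (k 0) → ℝ) (P : Fin (k 1) → ℝ)
    (hw : w ∈ stdSimplex ℝ (Fin (k 0))) (hP : P ∈ stdSimplex ℝ (Fin (k 1)))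
    (U : Fin (k 0) → Fin (k 1) → ℝ) (hU : ∀ a b, 0 ≤ U a b) :
    fEntropy f (fun z : Fin (k 0) × Fin (k 1) => w z.1 * P z.2) (fun z => U z.1 z.2) ≤
      ∑ b, P b * fEntropy f w (fun a => U a b) + ∑ a, w a * fEntropy f P (U a) := by
  let e := piFinTwoEquiv (fun i => Fin (k i))
  let Q : ∀ i, Fin (k i) → ℝ :=
    Fin.cons (α := fun i => Fin (k i) → ℝ) w (Fin.cons P finZeroElim)
  have hQ0 : Q 0 = w := rfl
  have hQ1 : Q 1 = P := rfl
  have h := hsub 2 k Q (fun z => U (z 0) (z 1))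
    (by intro i; fin_cases i; exacts [hw, hP]) (fun z => hU _ _)
  have hl := fEntropy_comp_equiv f e (fun z => w z.1 * P z.2) (fun z => U z.1 z.2)
  simp only [Fin.prod_univ_two, Fin.sum_univ_two, hQ0, hQ1] at h
  rw [← hl]
  refine h.trans (le_of_eq ?_)
  congr 1
  · rw [← e.symm.sum_comp, Fintype.sum_prod_type_right]
    refine Finset.sum_congr rfl fun b _ => ?_
    -- The inner entropy overwrites coordinate 0, so it does not depend on `a` and the weights `w a`
    -- sum out to 1.
    have : ∀ a : Fin (k 0), w (e.symm (a, b) 0) * P (e.symm (a, b) 1) *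
        fEntropy f w (fun a' => U (Function.update (e.symm (a, b)) 0 a' 0)
          (Function.update (e.symm (a, b)) 0 a' 1)) =
        w a * (P b * fEntropy f w (fun a' => U a' b)) := by
      intro a
      rw [mul_assoc]
      rfl
    rw [Finset.sum_congr rfl fun a _ => this a, ← Finset.sum_mul, hw.2, one_mul]
  · rw [← e.symm.sum_comp, Fintype.sum_prod_type]
    refine Finset.sum_congr rfl fun a _ => ?_
    have : ∀ b : Fin (k 1), w (e.symm (a, b) 0) * P (e.symm (a, b) 1) *
        fEntropy f P (fun b' => U (Function.update (e.symm (a, b)) 1 b' 0)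
          (Function.update (e.symm (a, b)) 1 b' 1)) =
        P b * (w a * fEntropy f P (U a)) := by
      intro b
      rw [mul_comm (w _), mul_assoc]
      rfl
    rw [Finset.sum_congr rfl fun a _ => this a, ← Finset.sum_mul, hP.2, one_mul]

theorem comp_equiv_mem_stdSimplex {A B : Type*} [Fintype A] [Fintype B] (e : A ≃ B) {P : B → ℝ}
    (hP : P ∈ stdSimplex ℝ B) : (fun a => P (e a)) ∈ stdSimplex ℝ A :=
  ⟨fun a => hP.1 (e a), by rw [e.sum_comp]; exact hP.2⟩

/-- A sub-additive `f`-entropy is a convex function of its argument. -/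
theorem SubadditiveEntropy.fEntropy_sum_le {A B : Type*} [Fintype A] [Fintype B] {f : ℝ → ℝ}
    (hsub : SubadditiveEntropy f) {w : A → ℝ} {P : B → ℝ} (hw : w ∈ stdSimplex ℝ A)
    (hP : P ∈ stdSimplex ℝ B) (U : A → B → ℝ) (hU : ∀ a b, 0 ≤ U a b) :
    fEntropy f P (fun b => ∑ a, w a * U a b) ≤ ∑ a, w a * fEntropy f P (U a) := by
  let eA := (Fintype.equivFin A).symm
  let eB := (Fintype.equivFin B).symm
  have h := hsub.fEntropy_pair_le ![Fintype.card A, Fintype.card B] (fun a => w (eA a))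
    (fun b => P (eB b)) (comp_equiv_mem_stdSimplex eA hw) (comp_equiv_mem_stdSimplex eB hP)
    (fun a b => U (eA a) (eB b)) (fun _ _ => hU _ _)
  have h' := fEntropy_prod_right f (fun a => w (eA a)) (fun b => P (eB b))
    (fun a b => U (eA a) (eB b))
  -- Sub-additivity and the chain rule share the term averaging entropies over `b`; cancelling it
  -- leaves exactly the convexity inequality.
  have h2 : fEntropy f (fun b => P (eB b)) (fun b => ∑ a, w (eA a) * U (eA a) (eB b)) ≤
      ∑ a, w (eA a) * fEntropy f (fun b => P (eB b)) (fun b => U (eA a) (eB b)) :=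
    le_of_add_le_add_left (h'.symm.le.trans h)
  simp only [fun a => fEntropy_comp_equiv f eB P (fun b => U (eA a) b)] at h2
  rw [eA.sum_comp (fun a => w a * fEntropy f P (U a))] at h2
  have h3 : ∀ b, ∑ a, w (eA a) * U (eA a) (eB b) = ∑ a, w a * U a (eB b) :=
    fun b => eA.sum_comp (fun a => w a * U a (eB b))
  simp only [h3] at h2
  rwa [fEntropy_comp_equiv f eB P (fun b => ∑ a, w a * U a b)] at h2

theorem fEntropy_const_mul_of_fin {f : ℝ → ℝ} {c κ : ℝ}
    (h : ∀ (k : ℕ) (P U : Fin k → ℝ), P ∈ stdSimplex ℝ (Fin k) → (∀ a, 0 ≤ U a) →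
      fEntropy f P (fun a => c * U a) = κ * fEntropy f P U)
    {A : Type*} [Fintype A] {P U : A → ℝ} (hP : P ∈ stdSimplex ℝ A) (hU : ∀ a, 0 ≤ U a) :
    fEntropy f P (fun a => c * U a) = κ * fEntropy f P U := by
  let e := (Fintype.equivFin A).symm
  rw [← fEntropy_comp_equiv f e P U, ← fEntropy_comp_equiv f e P (fun a => c * U a)]
  exact h _ _ _ (comp_equiv_mem_stdSimplex e hP) (fun _ => hU _)

/-! ### Conditional expectations and strong data processing -/

theorem marginalX_mem_stdSimplex {A B : Type*} [Fintype A] [Fintype B] {Q : A × B → ℝ}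
    (hQ : Q ∈ stdSimplex ℝ (A × B)) : marginalX Q ∈ stdSimplex ℝ A :=
  ⟨fun _ => Finset.sum_nonneg fun _ _ => hQ.1 _, by
    rw [← hQ.2, Fintype.sum_prod_type]; rfl⟩

theorem marginalY_mem_stdSimplex {A B : Type*} [Fintype A] [Fintype B] {Q : A × B → ℝ}
    (hQ : Q ∈ stdSimplex ℝ (A × B)) : marginalY Q ∈ stdSimplex ℝ B :=
  ⟨fun _ => Finset.sum_nonneg fun _ _ => hQ.1 _, by
    rw [← hQ.2, Fintype.sum_prod_type_right]; rfl⟩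

/-- The conditional expectation `E[U(X) | Y = b]` when `(X, Y)` has joint pmf `Q`. -/
noncomputable def condMean {A B : Type*} [Fintype A] (Q : A × B → ℝ) (U : A → ℝ) (b : B) : ℝ :=
  ∑ a, Q (a, b) / marginalY Q b * U a

theorem marginalY_mul_condMean {A B : Type*} [Fintype A] {Q : A × B → ℝ} {b : B}
    (hb : 0 < marginalY Q b) (U : A → ℝ) :
    marginalY Q b * condMean Q U b = ∑ a, Q (a, b) * U a := by
  rw [condMean, Finset.mul_sum]
  refine Finset.sum_congr rfl fun a _ => ?_
  field_simp

theorem condMean_nonneg {A B : Type*} [Fintype A] [Fintype B] {Q : A × B → ℝ}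
    (hQ : Q ∈ stdSimplex ℝ (A × B)) {U : A → ℝ} (hU : ∀ a, 0 ≤ U a) (b : B) :
    0 ≤ condMean Q U b :=
  Finset.sum_nonneg fun a _ =>
    mul_nonneg (div_nonneg (hQ.1 _) ((marginalY_mem_stdSimplex hQ).1 b)) (hU a)

theorem condMean_const_mul {A B : Type*} [Fintype A] (Q : A × B → ℝ) (c : ℝ) (U : A → ℝ) (b : B) :
    condMean Q (fun a => c * U a) b = c * condMean Q U b := by
  simp only [condMean, Finset.mul_sum]
  exact Finset.sum_congr rfl fun a _ => by ring

theorem condMean_const {A B : Type*} [Fintype A] {Q : A × B → ℝ} {b : B}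
    (hb : 0 < marginalY Q b) (c : ℝ) : condMean Q (fun _ => c) b = c := by
  rw [condMean, ← Finset.sum_mul, ← Finset.sum_div]
  change marginalY Q b / marginalY Q b * c = c
  rw [div_self hb.ne', one_mul]

theorem sum_marginalY_mul_condMean {A B : Type*} [Fintype A] [Fintype B] {Q : A × B → ℝ}
    (hY : ∀ b, 0 < marginalY Q b) (U : A → ℝ) :
    ∑ b, marginalY Q b * condMean Q U b = ∑ a, marginalX Q a * U a := by
  simp only [fun b => marginalY_mul_condMean (hY b) U, marginalX, Finset.sum_mul]
  exact Finset.sum_comm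

/-- The strong data processing inequality for the `f`-entropy with constant `K`. -/
def EntropyContracts {A B : Type*} [Fintype A] [Fintype B] (f : ℝ → ℝ) (Q : A × B → ℝ) (K : ℝ) :
    Prop :=
  ∀ U : A → ℝ, (∀ a, 0 ≤ U a) →
    fEntropy f (marginalY Q) (condMean Q U) ≤ K * fEntropy f (marginalX Q) U

/-- The joint pmf of two independent pairs. -/
def prodJoint {A B C D : Type*} (Q : A × B → ℝ) (R : C × D → ℝ) : (A × C) × (B × D) → ℝ :=
  fun z => Q (z.1.1, z.2.1) * R (z.1.2, z.2.2)

theorem marginalX_prodJoint {A B C D : Type*} [Fintype B] [Fintype D]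
    (Q : A × B → ℝ) (R : C × D → ℝ) :
    marginalX (prodJoint Q R) = fun z => marginalX Q z.1 * marginalX R z.2 := by
  funext z
  simp only [marginalX, prodJoint, Fintype.sum_prod_type, Finset.sum_mul_sum]

theorem marginalY_prodJoint {A B C D : Type*} [Fintype A] [Fintype C]
    (Q : A × B → ℝ) (R : C × D → ℝ) :
    marginalY (prodJoint Q R) = fun z => marginalY Q z.1 * marginalY R z.2 := by
  funext z
  simp only [marginalY, prodJoint, Fintype.sum_prod_type, Finset.sum_mul_sum]

/-- Given both outputs, the two inputs are independent, so the conditional expectation can be taken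
one input at a time. -/
theorem condMean_prodJoint {A B C D : Type*} [Fintype A] [Fintype C]
    (Q : A × B → ℝ) (R : C × D → ℝ) (U : A × C → ℝ) (z : B × D) :
    condMean (prodJoint Q R) U z =
      condMean R (fun c => condMean Q (fun a => U (a, c)) z.1) z.2 := by
  simp only [condMean, marginalY_prodJoint, prodJoint, Fintype.sum_prod_type_right, Finset.mul_sum]
  refine Finset.sum_congr rfl fun c _ => Finset.sum_congr rfl fun a _ => ?_
  rw [mul_div_mul_comm]
  ring

/-- Strong data processing inequalities tensorize when the `f`-entropy is sub-additive. -/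
theorem EntropyContracts.prod {A B C D : Type*} [Fintype A] [Fintype B] [Fintype C] [Fintype D]
    {f : ℝ → ℝ} (hsub : SubadditiveEntropy f) {Q : A × B → ℝ} {R : C × D → ℝ}
    (hQ : Q ∈ stdSimplex ℝ (A × B)) (hR : R ∈ stdSimplex ℝ (C × D))
    (hQY : ∀ b, 0 < marginalY Q b) (hRY : ∀ d, 0 < marginalY R d) {K : ℝ} (hK : 0 ≤ K)
    (h1 : EntropyContracts f Q K) (h2 : EntropyContracts f R K) :
    EntropyContracts f (prodJoint Q R) K := by
  intro U hU
  have hcm : condMean (prodJoint Q R) U =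
      fun z => condMean R (fun c => condMean Q (fun a => U (a, c)) z.1) z.2 :=
    funext fun z => condMean_prodJoint Q R U z
  have chainV := fEntropy_prod_left f (marginalY Q) (marginalY R)
    (fun b d => condMean R (fun c => condMean Q (fun a => U (a, c)) b) d)
  have chainU := fEntropy_prod_left f (marginalX Q) (marginalX R) (fun a c => U (a, c))
  rw [hcm, marginalX_prodJoint, marginalY_prodJoint, chainV, chainU]
  have hmean : (fun b => ∑ d, marginalY R d *
      condMean R (fun c => condMean Q (fun a => U (a, c)) b) d) =
      condMean Q (fun a => ∑ c, marginalX R c * U (a, c)) := by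
    funext b
    rw [sum_marginalY_mul_condMean hRY]
    simp only [condMean, Finset.mul_sum]
    rw [Finset.sum_comm]
    exact Finset.sum_congr rfl fun a _ => Finset.sum_congr rfl fun c _ => by ring
  have hsecond := h1 (fun a => ∑ c, marginalX R c * U (a, c)) fun a =>
    Finset.sum_nonneg fun c _ => mul_nonneg ((marginalX_mem_stdSimplex hR).1 c) (hU _)
  have hfirst : ∀ b, marginalY Q b * fEntropy f (marginalY R)
      (fun d => condMean R (fun c => condMean Q (fun a => U (a, c)) b) d) ≤
      K * ∑ a, Q (a, b) * fEntropy f (marginalX R) (fun c => U (a, c)) := by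
    intro b
    -- For fixed `b` this function of `c` need not have mean 1, which is why contraction is required
    -- for all nonnegative functions and not just densities.
    have e1 := h2 (fun c => condMean Q (fun a => U (a, c)) b)
      (fun c => condMean_nonneg hQ (fun a => hU _) b)
    have hw : (fun a => Q (a, b) / marginalY Q b) ∈ stdSimplex ℝ A :=
      ⟨fun a => div_nonneg (hQ.1 _) (hQY b).le, by
        rw [← Finset.sum_div]; exact div_self (hQY b).ne'⟩
    -- Convexity of the entropy, with the conditional law of the first input given `b` as weights.
    have e2 := hsub.fEntropy_sum_le hw (marginalX_mem_stdSimplex hR) (fun a c => U (a, c))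
      (fun a c => hU _)
    rw [← marginalY_mul_condMean (hQY b), mul_left_comm]
    exact mul_le_mul_of_nonneg_left (e1.trans (mul_le_mul_of_nonneg_left e2 hK)) (hQY b).le
  have hsum : ∑ b, K * ∑ a, Q (a, b) * fEntropy f (marginalX R) (fun c => U (a, c)) =
      K * ∑ a, marginalX Q a * fEntropy f (marginalX R) (fun c => U (a, c)) := by
    rw [← Finset.mul_sum, Finset.sum_comm]
    simp only [marginalX, Finset.sum_mul]
  rw [hmean, mul_add, ← hsum]
  exact add_le_add (Finset.sum_le_sum fun b _ => hfirst b) hsecond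

/-! ### Independent copies -/

theorem EntropyContracts.comp_equiv {A B C D : Type*} [Fintype A] [Fintype B] [Fintype C]
    [Fintype D] {f : ℝ → ℝ} {Q : C × D → ℝ} {K : ℝ} (h : EntropyContracts f Q K)
    (eA : A ≃ C) (eB : B ≃ D) : EntropyContracts f (fun z : A × B => Q (eA z.1, eB z.2)) K := by
  intro U hU
  have hX : marginalX (fun z : A × B => Q (eA z.1, eB z.2)) = fun a => marginalX Q (eA a) :=
    funext fun a => eB.sum_comp (fun d => Q (eA a, d))
  have hY : marginalY (fun z : A × B => Q (eA z.1, eB z.2)) = fun b => marginalY Q (eB b) :=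
    funext fun b => eA.sum_comp (fun c => Q (c, eB b))
  have hc : condMean (fun z : A × B => Q (eA z.1, eB z.2)) U =
      fun b => condMean Q (fun c => U (eA.symm c)) (eB b) := by
    funext b
    rw [condMean, condMean, hY, ← eA.sum_comp]
    simp
  have hXU := fEntropy_comp_equiv f eA (marginalX Q) (fun c => U (eA.symm c))
  simp only [Equiv.symm_apply_apply] at hXU
  rw [hX, hY, hc, fEntropy_comp_equiv f eB (marginalY Q), hXU]
  exact h (fun c => U (eA.symm c)) fun c => hU _

theorem marginalX_iidJoint {A B : Type*} [Fintype B] (Q : A × B → ℝ) (n : ℕ) (x : Fin n → A) :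
    marginalX (iidJoint Q n) x = ∏ i, marginalX Q (x i) :=
  (Fintype.prod_sum fun i y => Q (x i, y)).symm

theorem marginalY_iidJoint {A B : Type*} [Fintype A] (Q : A × B → ℝ) (n : ℕ) (y : Fin n → B) :
    marginalY (iidJoint Q n) y = ∏ i, marginalY Q (y i) :=
  (Fintype.prod_sum fun i x => Q (x, y i)).symm

theorem iidJoint_mem_stdSimplex {A B : Type*} [Fintype A] [Fintype B] {Q : A × B → ℝ}
    (hQ : Q ∈ stdSimplex ℝ (A × B)) (n : ℕ) :
    iidJoint Q n ∈ stdSimplex ℝ ((Fin n → A) × (Fin n → B)) := by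
  refine ⟨fun z => Finset.prod_nonneg fun i _ => hQ.1 _, ?_⟩
  rw [Fintype.sum_prod_type]
  change ∑ x, marginalX (iidJoint Q n) x = 1
  simp only [marginalX_iidJoint]
  rw [← Fintype.prod_sum fun (_ : Fin n) a => marginalX Q a]
  simp [(marginalX_mem_stdSimplex hQ).2]

theorem iidJoint_succ {A B : Type*} (Q : A × B → ℝ) (n : ℕ) :
    iidJoint Q (n + 1) = fun z => prodJoint Q (iidJoint Q n)
      ((Fin.consEquiv fun _ => A).symm z.1, (Fin.consEquiv fun _ => B).symm z.2) :=
  funext fun _ => Fin.prod_univ_succ _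

/-- Strong data processing inequalities extend to independent copies. -/
theorem EntropyContracts.iidJoint {A B : Type*} [Fintype A] [Fintype B] {f : ℝ → ℝ}
    (hsub : SubadditiveEntropy f) {Q : A × B → ℝ} (hQ : Q ∈ stdSimplex ℝ (A × B))
    (hY : ∀ b, 0 < marginalY Q b) {K : ℝ} (hK : 0 ≤ K) (h : EntropyContracts f Q K) (n : ℕ) :
    EntropyContracts f (iidJoint Q n) K := by
  induction n with
  | zero =>
    intro U _
    -- With no copies both spaces are single points, where every entropy is 0.
    simp [fEntropy, marginalX_iidJoint, marginalY_iidJoint]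
  | succ n ih =>
    rw [iidJoint_succ]
    refine EntropyContracts.comp_equiv (h.prod hsub hQ (iidJoint_mem_stdSimplex hQ n) hY ?_ hK ih)
      _ _
    intro y
    rw [marginalY_iidJoint]
    exact Finset.prod_pos fun i _ => hY _

theorem sum_prod_mul_apply_zero {A : Type*} [Fintype A] {P : A → ℝ} (hP : ∑ a, P a = 1) (n : ℕ)
    (g : A → ℝ) : ∑ x : Fin (n + 1) → A, (∏ i, P (x i)) * g (x 0) = ∑ a, P a * g a := by
  have h : ∑ x : Fin n → A, ∏ i, P (x i) = 1 := by
    rw [← Fintype.prod_sum fun (_ : Fin n) a => P a]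
    simp [hP]
  rw [← (Fin.consEquiv fun _ => A).sum_comp, Fintype.sum_prod_type]
  refine Finset.sum_congr rfl fun a _ => ?_
  have h' : ∀ x : Fin n → A, (∏ i, P ((Fin.consEquiv fun _ => A) (a, x) i)) *
      g ((Fin.consEquiv fun _ => A) (a, x) 0) = (∏ i, P (x i)) * (P a * g a) := fun x => by
    simp [Fin.consEquiv, Fin.prod_univ_succ]
    ring
  rw [Finset.sum_congr rfl fun x _ => h' x, ← Finset.sum_mul, h, one_mul]

theorem fEntropy_iidJoint_apply_zero {A : Type*} [Fintype A] (f : ℝ → ℝ) {P : A → ℝ}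
    (hP : P ∈ stdSimplex ℝ A) (n : ℕ) (U : A → ℝ) :
    fEntropy f (fun x : Fin (n + 1) → A => ∏ i, P (x i)) (fun x => U (x 0)) = fEntropy f P U := by
  rw [fEntropy, fEntropy, sum_prod_mul_apply_zero hP.2 n fun a => f (U a),
    sum_prod_mul_apply_zero hP.2]

/-- The remaining pairs are independent of the first, so their outputs carry no information on `x
0`. -/
theorem condMean_iidJoint_apply_zero {A B : Type*} [Fintype A] {Q : A × B → ℝ}
    (hY : ∀ b, 0 < marginalY Q b) (n : ℕ) (U : A → ℝ) (y : Fin (n + 1) → B) :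
    condMean (iidJoint Q (n + 1)) (fun x => U (x 0)) y = condMean Q U (y 0) := by
  have h := condMean_prodJoint Q (iidJoint Q n) (fun z => U z.1) (y 0, Fin.tail y)
  have hpos : 0 < marginalY (iidJoint Q n) (Fin.tail y) := by
    rw [marginalY_iidJoint]
    exact Finset.prod_pos fun i _ => hY _
  simp only [condMean_const hpos] at h
  rw [← h, condMean, condMean, ← (Fin.consEquiv fun _ => A).symm.sum_comp, iidJoint_succ]
  refine Finset.sum_congr rfl fun x _ => ?_
  congr 2
  simp only [marginalY]
  exact (Fin.consEquiv fun _ => A).symm.sum_comp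
    (fun c => prodJoint Q (iidJoint Q n) (c, (y 0, Fin.tail y)))

/-! ### Contraction coefficients through entropies -/

/-- Positivity of `P` keeps `recession` out of play; the divergence is a real number, so the
finiteness constraint in the supremum is automatic. -/
theorem fDiv_mul_self {A : Type*} [Fintype A] {f : ℝ → ℝ} (hf1 : f 1 = 0) {P : A → ℝ}
    (hP : ∀ a, 0 < P a) {U : A → ℝ} (hU : ∑ a, P a * U a = 1) :
    fDiv f (fun a => P a * U a) P = ((fEntropy f P U : ℝ) : EReal) := by
  have h : ∀ a, fDivTerm f (P a * U a) (P a) = ((P a * f (U a) : ℝ) : EReal) := fun a => by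
    rw [fDivTerm, if_neg (hP a).ne', mul_div_cancel_left₀ _ (hP a).ne']
  rw [fDiv, Finset.sum_congr rfl fun a _ => h a, fEntropy, hU, hf1, sub_zero]
  induction (Finset.univ : Finset A) using Finset.cons_induction with
  | empty => simp
  | cons a s ha ih => rw [Finset.sum_cons, Finset.sum_cons, EReal.coe_add, ih]

theorem condChannel_mulVec {A B : Type*} [Fintype A] [Fintype B] {Q : A × B → ℝ}
    (hX : ∀ a, 0 < marginalX Q a) (U : A → ℝ) :
    (condChannel Q *ᵥ fun a => marginalX Q a * U a) = fun b => ∑ a, Q (a, b) * U a := by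
  funext b
  refine Finset.sum_congr rfl fun a _ => ?_
  change Q (a, b) / marginalX Q a * (marginalX Q a * U a) = _
  rw [← mul_assoc, div_mul_cancel₀ _ (hX a).ne']

theorem condChannel_mulVec_marginalX {A B : Type*} [Fintype A] [Fintype B] {Q : A × B → ℝ}
    (hX : ∀ a, 0 < marginalX Q a) : condChannel Q *ᵥ marginalX Q = marginalY Q := by
  simpa [marginalY, funext_iff] using condChannel_mulVec hX 1

theorem eta_eq_zero {A B : Type*} [Fintype A] [Fintype B] (f : ℝ → ℝ) {Q : A × B → ℝ}
    (hX : ∀ a, 0 < marginalX Q a) (h : (∃ a, marginalX Q a = 1) ∨ ∃ b, marginalY Q b = 1) :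
    eta f Q = 0 := by
  rw [eta, contractionCoeff, condChannel_mulVec_marginalX hX, if_pos h]

/-- The ratio of output to input `f`-divergence, when the input has density `U`. -/
theorem fDiv_ratio {A B : Type*} [Fintype A] [Fintype B] {f : ℝ → ℝ} (hf1 : f 1 = 0)
    {Q : A × B → ℝ} (hX : ∀ a, 0 < marginalX Q a) (hY : ∀ b, 0 < marginalY Q b) {U : A → ℝ}
    (hU : ∑ a, marginalX Q a * U a = 1) :
    fDiv f (condChannel Q *ᵥ fun a => marginalX Q a * U a) (marginalY Q) /
        fDiv f (fun a => marginalX Q a * U a) (marginalX Q) =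
      ((fEntropy f (marginalY Q) (condMean Q U) / fEntropy f (marginalX Q) U : ℝ) : EReal) := by
  have h : (condChannel Q *ᵥ fun a => marginalX Q a * U a) =
      fun b => marginalY Q b * condMean Q U b := by
    rw [condChannel_mulVec hX]
    exact funext fun b => (marginalY_mul_condMean (hY b) U).symm
  rw [h, fDiv_mul_self hf1 hX hU,
    fDiv_mul_self hf1 hY ((sum_marginalY_mul_condMean hY U).trans hU), EReal.coe_div]

theorem le_eta {A B : Type*} [Fintype A] [Fintype B] {f : ℝ → ℝ} (hf1 : f 1 = 0)
    {Q : A × B → ℝ} (hX : ∀ a, 0 < marginalX Q a) (hY : ∀ b, 0 < marginalY Q b)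
    (hne : ¬((∃ a, marginalX Q a = 1) ∨ ∃ b, marginalY Q b = 1)) {U : A → ℝ}
    (hU : ∀ a, 0 ≤ U a) (hU1 : ∑ a, marginalX Q a * U a = 1)
    (hpos : 0 < fEntropy f (marginalX Q) U) :
    ((fEntropy f (marginalY Q) (condMean Q U) / fEntropy f (marginalX Q) U : ℝ) : EReal) ≤
      eta f Q := by
  rw [eta, contractionCoeff, condChannel_mulVec_marginalX hX, if_neg hne, ← fDiv_ratio hf1 hX hY hU1]
  refine le_iSup₂ (f := fun (R : A → ℝ) (_ : R ∈ {R : A → ℝ | R ∈ stdSimplex ℝ A ∧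
      0 < fDiv f R (marginalX Q) ∧ fDiv f R (marginalX Q) < ⊤}) =>
    fDiv f (condChannel Q *ᵥ R) (marginalY Q) / fDiv f R (marginalX Q)) _ ?_
  rw [mem_ofPred_eq, fDiv_mul_self hf1 hX hU1]
  exact ⟨⟨fun a => mul_nonneg (hX a).le (hU a), hU1⟩, EReal.coe_pos.2 hpos, EReal.coe_lt_top _⟩

theorem eta_le {A B : Type*} [Fintype A] [Fintype B] {f : ℝ → ℝ} (hf1 : f 1 = 0)
    {Q : A × B → ℝ} (hX : ∀ a, 0 < marginalX Q a) (hY : ∀ b, 0 < marginalY Q b)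
    (hne : ¬((∃ a, marginalX Q a = 1) ∨ ∃ b, marginalY Q b = 1)) {K : EReal}
    (h : ∀ U : A → ℝ, (∀ a, 0 ≤ U a) → ∑ a, marginalX Q a * U a = 1 →
      0 < fEntropy f (marginalX Q) U →
      ((fEntropy f (marginalY Q) (condMean Q U) / fEntropy f (marginalX Q) U : ℝ) : EReal) ≤ K) :
    eta f Q ≤ K := by
  rw [eta, contractionCoeff, condChannel_mulVec_marginalX hX, if_neg hne]
  refine iSup₂_le fun R hR => ?_
  obtain ⟨hR, hpos, -⟩ := hR
  obtain ⟨U, rfl⟩ : ∃ U : A → ℝ, R = fun a => marginalX Q a * U a :=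
    ⟨fun a => R a / marginalX Q a, funext fun a => (mul_div_cancel₀ _ (hX a).ne').symm⟩
  rw [fDiv_mul_self hf1 hX hR.2] at hpos
  rw [fDiv_ratio hf1 hX hY hR.2]
  exact h U (fun a => (mul_nonneg_iff_of_pos_left (hX a)).1 (hR.1 a)) hR.2 (EReal.coe_pos.1 hpos)

/-! ### Comparison of the `f`-entropy with the `χ²`-entropy -/

theorem ConvexOn.tangent_le {S : Set ℝ} {f : ℝ → ℝ} (hf : ConvexOn ℝ S f) {a t f' : ℝ}
    (ha : a ∈ S) (ht : t ∈ S) (hd : HasDerivAt f f' a) : f a + f' * (t - a) ≤ f t := by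
  rcases lt_trichotomy t a with h | rfl | h
  · have := hf.slope_le_of_hasDerivAt ht ha h hd
    rw [slope_def_field, div_le_iff₀ (sub_pos.2 h)] at this
    linarith
  · simp
  · have := hf.le_slope_of_hasDerivAt ha ht h hd
    rw [slope_def_field, le_div_iff₀ (sub_pos.2 h)] at this
    linarith

/-- A convex function lies above its tangent at 1; the value at 0 follows by passing to the limit.
-/
theorem sub_deriv_mul_nonneg {f : ℝ → ℝ} (hf0 : Tendsto f (𝓝[>] 0) (𝓝 (f 0)))
    (hconv : ConvexOn ℝ (Ioi 0) f) (hd : DifferentiableAt ℝ f 1) (hf1 : f 1 = 0) {t : ℝ}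
    (ht : 0 ≤ t) : 0 ≤ f t - deriv f 1 * (t - 1) := by
  have hpos : ∀ s : ℝ, 0 < s → 0 ≤ f s - deriv f 1 * (s - 1) := fun s hs => by
    have := hconv.tangent_le (mem_Ioi.2 one_pos) (mem_Ioi.2 hs) hd.hasDerivAt
    linarith
  rcases ht.eq_or_lt with rfl | ht
  · have hlin : Tendsto (fun s : ℝ => deriv f 1 * (s - 1)) (𝓝[>] 0) (𝓝 (deriv f 1 * (0 - 1))) :=
      ((by fun_prop : Continuous fun s : ℝ => deriv f 1 * (s - 1)).tendsto 0).mono_left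
        nhdsWithin_le_nhds
    exact ge_of_tendsto (hf0.sub hlin) (eventually_mem_nhdsWithin.mono fun s hs => hpos s hs)
  · exact hpos t ht

theorem quadratic_le_of_nonneg {f : ℝ → ℝ} (hf0 : Tendsto f (𝓝[>] 0) (𝓝 (f 0))) {c k l : ℝ}
    (h : ∀ t : ℝ, 0 < t → k * (t - 1) ^ 2 ≤ (f t - c * (t - 1)) * (1 - l * (t - 1)))
    {t : ℝ} (ht : 0 ≤ t) : k * (t - 1) ^ 2 ≤ (f t - c * (t - 1)) * (1 - l * (t - 1)) := by
  rcases ht.eq_or_lt with rfl | ht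
  · have h0 : ∀ g : ℝ → ℝ, Continuous g → Tendsto g (𝓝[>] 0) (𝓝 (g 0)) := fun g hg =>
      (hg.tendsto 0).mono_left nhdsWithin_le_nhds
    exact le_of_tendsto_of_tendsto (h0 (fun s => k * (s - 1) ^ 2) (by fun_prop))
      ((hf0.sub (h0 (fun s => c * (s - 1)) (by fun_prop))).mul
        (h0 (fun s => 1 - l * (s - 1)) (by fun_prop)))
      (eventually_mem_nhdsWithin.mono fun s hs => h s hs)
  · exact h t ht

/-- The concave function `(f x - f 0) / x` lies below its tangent at 1, which has value `-f 0` and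
slope `f'(1) + f 0` there; multiply by `t`. -/
theorem le_quadratic_of_concaveOn {f : ℝ → ℝ} (hd : DifferentiableAt ℝ f 1) (hf1 : f 1 = 0)
    (hg : ConcaveOn ℝ (Ioi 0) (fun x => (f x - f 0) / x)) {t : ℝ} (ht : 0 ≤ t) :
    f t ≤ f 0 - f 0 * t + (deriv f 1 + f 0) * (t * (t - 1)) := by
  rcases ht.eq_or_lt with rfl | ht
  · simp
  · have hder : HasDerivAt (fun x => (f x - f 0) / x) (deriv f 1 + f 0) 1 := by
      simpa [hf1] using
        (hd.hasDerivAt.sub_const (f 0)).fun_div (hasDerivAt_id' (1 : ℝ)) one_ne_zero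
    have h := hg.neg.tangent_le (mem_Ioi.2 one_pos) (mem_Ioi.2 ht) hder.neg
    have h' : (f t - f 0) / t ≤ - f 0 + (deriv f 1 + f 0) * (t - 1) := by
      have h1 : -((f 1 - f 0) / 1) + -(deriv f 1 + f 0) * (t - 1) ≤ -((f t - f 0) / t) := h
      rw [hf1, div_one] at h1
      linarith
    rw [div_le_iff₀ ht] at h'
    linarith

section

variable {A : Type*} [Fintype A] {P U : A → ℝ}

theorem fEntropy_chiSqFun (hP : P ∈ stdSimplex ℝ A) (hU : ∑ a, P a * U a = 1) :
    fEntropy chiSqFun P U = ∑ a, P a * (U a - 1) ^ 2 := by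
  have h : ∀ a, P a * (U a - 1) ^ 2 = P a * (U a ^ 2 - 1) - 2 * (P a * U a) + 2 * P a :=
    fun a => by ring
  simp only [h, Finset.sum_add_distrib, Finset.sum_sub_distrib, ← Finset.mul_sum, hU, hP.2]
  simp [fEntropy, chiSqFun, hU]

/-- Averaging the quadratic bound: the mean of `U` is 1, so the affine part vanishes and `U (U - 1)`
averages to the `χ²`-entropy. -/
theorem fEntropy_le_chiSq {f : ℝ → ℝ} (hd : DifferentiableAt ℝ f 1) (hf1 : f 1 = 0)
    (hg : ConcaveOn ℝ (Ioi 0) (fun x => (f x - f 0) / x)) (hP : P ∈ stdSimplex ℝ A)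
    (hU : ∀ a, 0 ≤ U a) (hU1 : ∑ a, P a * U a = 1) :
    fEntropy f P U ≤ (deriv f 1 + f 0) * fEntropy chiSqFun P U := by
  have h := Finset.sum_le_sum fun a (_ : a ∈ Finset.univ) =>
    mul_le_mul_of_nonneg_left (le_quadratic_of_concaveOn hd hf1 hg (hU a)) (hP.1 a)
  have h2 : ∀ a, P a * (f 0 - f 0 * U a + (deriv f 1 + f 0) * (U a * (U a - 1))) =
      f 0 * P a - f 0 * (P a * U a) +
        (deriv f 1 + f 0) * (P a * (U a - 1) ^ 2 + P a * U a - P a) := fun a => by ring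
  simp only [h2, Finset.sum_add_distrib, Finset.sum_sub_distrib, ← Finset.mul_sum, hU1, hP.2] at h
  rw [fEntropy_chiSqFun hP hU1, fEntropy, hU1, hf1]
  linarith

/-- A generalized Pinsker inequality. -/
theorem sq_sum_abs_le_fEntropy {f : ℝ → ℝ} (hf1 : f 1 = 0) {c k l : ℝ} (hk : 0 < k)
    (hnn : ∀ t : ℝ, 0 ≤ t → 0 ≤ f t - c * (t - 1))
    (h : ∀ t : ℝ, 0 ≤ t → k * (t - 1) ^ 2 ≤ (f t - c * (t - 1)) * (1 - l * (t - 1)))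
    (hP : P ∈ stdSimplex ℝ A) (hU : ∀ a, 0 ≤ U a) (hU1 : ∑ a, P a * U a = 1) :
    k * (∑ a, |P a * (U a - 1)|) ^ 2 ≤ fEntropy f P U := by
  -- Away from 1 the product in `h` is positive and its first factor is nonnegative, so the second
  -- must be positive.
  have hl : ∀ t : ℝ, 0 ≤ t → 0 ≤ 1 - l * (t - 1) := fun t ht => by
    rcases eq_or_ne t 1 with rfl | hne
    · simp
    · have h1 : 0 < (f t - c * (t - 1)) * (1 - l * (t - 1)) :=
        lt_of_lt_of_le (mul_pos hk (sq_pos_of_ne_zero (sub_ne_zero.2 hne))) (h t ht)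
      exact (pos_of_mul_pos_right h1 (hnn t ht)).le
  -- Cauchy–Schwarz with the two factors of `h`: the first averages to the entropy over `k`, the
  -- second to 1.
  have hcs := Finset.sum_sq_le_sum_mul_sum_of_sq_le_mul Finset.univ
    (r := fun a => |P a * (U a - 1)|) (f := fun a => P a * (f (U a) - c * (U a - 1)) / k)
    (g := fun a => P a * (1 - l * (U a - 1)))
    (fun a _ => div_nonneg (mul_nonneg (hP.1 a) (hnn _ (hU a))) hk.le)
    (fun a _ => mul_nonneg (hP.1 a) (hl _ (hU a))) (fun a _ => by
      rw [sq_abs, div_mul_eq_mul_div, le_div_iff₀ hk]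
      have := mul_le_mul_of_nonneg_left (h _ (hU a)) (sq_nonneg (P a))
      linarith)
  have e1 : ∑ a, P a * (1 - l * (U a - 1)) = 1 := by
    have : ∀ a, P a * (1 - l * (U a - 1)) = P a - l * (P a * U a) + l * P a := fun a => by ring
    simp only [this, Finset.sum_add_distrib, Finset.sum_sub_distrib, ← Finset.mul_sum, hU1, hP.2]
    ring
  have e2 : ∑ a, P a * (f (U a) - c * (U a - 1)) = fEntropy f P U := by
    have : ∀ a, P a * (f (U a) - c * (U a - 1)) = P a * f (U a) - c * (P a * U a) + c * P a :=
      fun a => by ring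
    simp only [this, Finset.sum_add_distrib, Finset.sum_sub_distrib, ← Finset.mul_sum, hU1, hP.2]
    rw [fEntropy, hU1, hf1]
    ring
  rw [e1, mul_one, ← Finset.sum_div, e2, le_div_iff₀ hk] at hcs
  linarith

/-- Each entry is minus the sum of the others, hence at most half the `ℓ¹` norm in absolute value;
multiply by `|d a|` and sum. -/
theorem two_mul_sum_sq_le_sq_sum_abs {d : A → ℝ} (hd : ∑ a, d a = 0) :
    2 * ∑ a, d a ^ 2 ≤ (∑ a, |d a|) ^ 2 := by
  classical
  have h : ∀ a, 2 * |d a| ≤ ∑ b, |d b| := fun a => by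
    have h1 := Finset.add_sum_erase Finset.univ d (Finset.mem_univ a)
    have h2 := Finset.add_sum_erase Finset.univ (fun b => |d b|) (Finset.mem_univ a)
    have h3 := Finset.abs_sum_le_sum_abs d (Finset.univ.erase a)
    have h4 : ∑ b ∈ Finset.univ.erase a, d b = - d a := by linarith
    rw [h4, abs_neg] at h3
    linarith
  rw [sq, Finset.mul_sum, Finset.mul_sum]
  refine Finset.sum_le_sum fun a _ => ?_
  rw [← sq_abs]
  nlinarith [h a, abs_nonneg (d a)]

/-- Pinsker bounds the entropy below by an `ℓ¹` norm squared, hence by twice the `ℓ²` norm squared;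
one factor `P a` of `(P a)²` is then bounded below by `m`. -/
theorem chiSq_le_fEntropy {f : ℝ → ℝ} (hf1 : f 1 = 0) {c k l m : ℝ} (hk : 0 < k)
    (hnn : ∀ t : ℝ, 0 ≤ t → 0 ≤ f t - c * (t - 1))
    (h : ∀ t : ℝ, 0 ≤ t → k * (t - 1) ^ 2 ≤ (f t - c * (t - 1)) * (1 - l * (t - 1)))
    (hm : ∀ a, m ≤ P a) (hP : P ∈ stdSimplex ℝ A) (hU : ∀ a, 0 ≤ U a)
    (hU1 : ∑ a, P a * U a = 1) :
    2 * k * m * fEntropy chiSqFun P U ≤ fEntropy f P U := by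
  have hd : ∑ a, P a * (U a - 1) = 0 := by
    simp [mul_sub, Finset.sum_sub_distrib, hU1, hP.2]
  have h1 := two_mul_sum_sq_le_sq_sum_abs hd
  have h2 : m * ∑ a, P a * (U a - 1) ^ 2 ≤ ∑ a, (P a * (U a - 1)) ^ 2 := by
    rw [Finset.mul_sum]
    refine Finset.sum_le_sum fun a _ => ?_
    have := mul_le_mul_of_nonneg_right (hm a) (mul_nonneg (hP.1 a) (sq_nonneg (U a - 1)))
    linarith
  refine le_trans ?_ (sq_sum_abs_le_fEntropy hf1 hk hnn h hP hU hU1)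
  rw [fEntropy_chiSqFun hP hU1]
  have := mul_le_mul_of_nonneg_left ((mul_le_mul_of_nonneg_left h2 two_pos.le).trans h1) hk.le
  linarith

end

/-! ### Local behaviour of the `f`-entropy -/

/-- Second-order Taylor expansion with Peano remainder. -/
theorem tendsto_second_order {f : ℝ → ℝ} {a : ℝ} (hd : ∀ᶠ t in 𝓝 a, DifferentiableAt ℝ f t)
    (hd2 : DifferentiableAt ℝ (deriv f) a) :
    Tendsto (fun t => (f t - f a - deriv f a * (t - a)) / (t - a) ^ 2) (𝓝[≠] a)
      (𝓝 (deriv (deriv f) a / 2)) := by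
  have hcont : ContinuousAt f a := hd.self_of_nhds.continuousAt
  refine HasDerivAt.lhopital_zero_nhdsNE (f' := fun t => deriv f t - deriv f a)
    (g' := fun t => 2 * (t - a)) ?_ ?_ ?_ ?_ ?_ ?_
  · filter_upwards [hd.filter_mono nhdsWithin_le_nhds] with t ht
    exact (ht.hasDerivAt.sub_const (f a)).fun_sub
      (by simpa using ((hasDerivAt_id t).sub_const a).const_mul (deriv f a))
  · refine Eventually.of_forall fun t => ?_
    simpa using ((hasDerivAt_id t).sub_const a).fun_pow 2
  · filter_upwards [self_mem_nhdsWithin] with t ht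
    exact mul_ne_zero two_ne_zero (sub_ne_zero.2 ht)
  · have : ContinuousAt (fun t => f t - f a - deriv f a * (t - a)) a := by fun_prop
    simpa using this.tendsto.mono_left (nhdsWithin_le_nhds (s := {a}ᶜ))
  · have : ContinuousAt (fun t : ℝ => (t - a) ^ 2) a := by fun_prop
    simpa using this.tendsto.mono_left (nhdsWithin_le_nhds (s := {a}ᶜ))
  -- The quotient of derivatives is half the slope of `f'` at `a`, so the second derivative is
  -- needed only at `a`.
  · have := (hasDerivAt_iff_tendsto_slope.1 hd2.hasDerivAt).div_const 2
    refine this.congr fun t => ?_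
    rw [slope_def_field, div_div, mul_comm]

/-- The first-order term drops out because `U - 1` has mean 0. -/
theorem tendsto_fEntropy_div_sq {f : ℝ → ℝ} (hd : ∀ᶠ t in 𝓝 (1 : ℝ), DifferentiableAt ℝ f t)
    (hd2 : DifferentiableAt ℝ (deriv f) 1) (hf1 : f 1 = 0) {A : Type*} [Fintype A] {P U : A → ℝ}
    (hP : P ∈ stdSimplex ℝ A) (hU1 : ∑ a, P a * U a = 1) :
    Tendsto (fun ε : ℝ => fEntropy f P (fun a => 1 + ε * (U a - 1)) / ε ^ 2) (𝓝[>] 0)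
      (𝓝 (deriv (deriv f) 1 / 2 * fEntropy chiSqFun P U)) := by
  have hpt : ∀ u : ℝ, Tendsto (fun ε : ℝ => (f (1 + ε * u) - deriv f 1 * (ε * u)) / ε ^ 2) (𝓝[>] 0)
      (𝓝 (deriv (deriv f) 1 / 2 * u ^ 2)) := by
    intro u
    rcases eq_or_ne u 0 with rfl | hu
    · simp [hf1]
    · have hto : Tendsto (fun ε : ℝ => 1 + ε * u) (𝓝[>] 0) (𝓝[≠] 1) := by
        refine tendsto_nhdsWithin_iff.2 ⟨?_, ?_⟩
        · have : Continuous fun ε : ℝ => 1 + ε * u := by fun_prop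
          simpa using (this.tendsto 0).mono_left (nhdsWithin_le_nhds (s := Ioi 0))
        · filter_upwards [self_mem_nhdsWithin] with ε hε
          simpa [hu] using (ne_of_gt hε : ε ≠ 0)
      refine (((tendsto_second_order hd hd2).comp hto).mul_const (u ^ 2)).congr' ?_
      filter_upwards [self_mem_nhdsWithin] with ε hε
      have hε' : ε ≠ 0 := ne_of_gt hε
      simp only [Function.comp_apply, hf1, sub_zero, add_sub_cancel_left]
      field_simp
  have hsum := tendsto_finsetSum Finset.univ fun a _ => (hpt (U a - 1)).const_mul (P a)
  have hlim : ∑ a, P a * (deriv (deriv f) 1 / 2 * (U a - 1) ^ 2) =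
      deriv (deriv f) 1 / 2 * fEntropy chiSqFun P U := by
    rw [fEntropy_chiSqFun hP hU1, Finset.mul_sum]
    exact Finset.sum_congr rfl fun a _ => by ring
  rw [hlim] at hsum
  refine hsum.congr fun ε => ?_
  have hz : ∑ a, P a * (U a - 1) = 0 := by
    simp [mul_sub, Finset.sum_sub_distrib, hU1, hP.2]
  have hm : ∑ a, P a * (1 + ε * (U a - 1)) = 1 := by
    have : ∀ a, P a * (1 + ε * (U a - 1)) = P a + ε * (P a * (U a - 1)) := fun a => by ring
    simp only [this, Finset.sum_add_distrib, ← Finset.mul_sum, hP.2, hz]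
    ring
  rw [fEntropy, hm, hf1, sub_zero, Finset.sum_div]
  have : ∀ a, P a * ((f (1 + ε * (U a - 1)) - deriv f 1 * (ε * (U a - 1))) / ε ^ 2) =
      P a * f (1 + ε * (U a - 1)) / ε ^ 2 - deriv f 1 * ε / ε ^ 2 * (P a * (U a - 1)) :=
    fun a => by ring
  simp only [this, Finset.sum_sub_distrib, ← Finset.mul_sum, hz]
  ring

/-- The `χ²` contraction coefficient is a lower bound for every sufficiently smooth `f`. -/
theorem eta_chiSqFun_le_eta {f : ℝ → ℝ} (hd : ∀ᶠ t in 𝓝 (1 : ℝ), DifferentiableAt ℝ f t)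
    (hd2 : DifferentiableAt ℝ (deriv f) 1) (hf1 : f 1 = 0) (hf2 : 0 < deriv (deriv f) 1)
    {A B : Type*} [Fintype A] [Fintype B] {Q : A × B → ℝ} (hQ : Q ∈ stdSimplex ℝ (A × B))
    (hX : ∀ a, 0 < marginalX Q a) (hY : ∀ b, 0 < marginalY Q b) :
    eta chiSqFun Q ≤ eta f Q := by
  by_cases hne : (∃ a, marginalX Q a = 1) ∨ ∃ b, marginalY Q b = 1
  · rw [eta_eq_zero _ hX hne, eta_eq_zero _ hX hne]
  refine eta_le (by simp [chiSqFun]) hX hY hne fun U hU hU1 hpos => ?_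
  have hPX := marginalX_mem_stdSimplex hQ
  have hlimX := tendsto_fEntropy_div_sq hd hd2 hf1 hPX hU1
  have hlimY := tendsto_fEntropy_div_sq hd hd2 hf1 (marginalY_mem_stdSimplex hQ)
    ((sum_marginalY_mul_condMean hY U).trans hU1)
  have hlim := hlimY.div hlimX (by positivity)
  rw [mul_div_mul_left _ _ (by positivity)] at hlim
  refine le_of_tendsto ((continuous_coe_real_ereal.tendsto _).comp hlim) ?_
  -- The perturbed density must have positive entropy to enter the supremum; `ε ≤ 1` keeps it
  -- nonnegative.
  have hev : ∀ᶠ ε : ℝ in 𝓝[>] 0,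
      0 < fEntropy f (marginalX Q) (fun a => 1 + ε * (U a - 1)) / ε ^ 2 :=
    hlimX.eventually (lt_mem_nhds (by positivity))
  filter_upwards [hev, self_mem_nhdsWithin,
    mem_nhdsWithin_of_mem_nhds (Iic_mem_nhds (zero_lt_one' ℝ))] with ε hε hε0 hε1
  have hε0 : 0 < ε := hε0
  have hε1 : ε ≤ 1 := hε1
  have hcm : condMean Q (fun a => 1 + ε * (U a - 1)) = fun b => 1 + ε * (condMean Q U b - 1) := by
    funext b
    have h1 := condMean_const (hY b) (1 - ε)
    have h2 := condMean_const_mul Q ε U b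
    have h3 : condMean Q (fun a => 1 + ε * (U a - 1)) b =
        condMean Q (fun _ => 1 - ε) b + condMean Q (fun a => ε * U a) b := by
      rw [condMean, condMean, condMean, ← Finset.sum_add_distrib]
      exact Finset.sum_congr rfl fun a _ => by ring
    rw [h3, h1, h2]
    ring
  have hm : ∑ a, marginalX Q a * (1 + ε * (U a - 1)) = 1 := by
    have : ∀ a, marginalX Q a * (1 + ε * (U a - 1)) =
        (1 - ε) * marginalX Q a + ε * (marginalX Q a * U a) := fun a => by ring
    simp only [this, Finset.sum_add_distrib, ← Finset.mul_sum, hPX.2, hU1]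
    ring
  have hle := le_eta hf1 hX hY hne (U := fun a => 1 + ε * (U a - 1))
    (fun a => by nlinarith [hU a]) hm ((div_pos_iff_of_pos_right (by positivity)).1 hε)
  rw [hcm] at hle
  simpa [div_div_div_cancel_right₀ (pow_ne_zero 2 hε0.ne')] using hle

/-! ### Comparison of contraction coefficients -/

/-- For a homogeneous `f`-entropy, it suffices to consider probability densities. -/
theorem EntropyContracts.of_mean_one {f : ℝ → ℝ} (hhom : HomogeneousEntropy f) {A B : Type*}
    [Fintype A] [Fintype B] {Q : A × B → ℝ} (hQ : Q ∈ stdSimplex ℝ (A × B))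
    (hX : ∀ a, 0 < marginalX Q a) {K : ℝ}
    (h : ∀ U : A → ℝ, (∀ a, 0 ≤ U a) → ∑ a, marginalX Q a * U a = 1 →
      fEntropy f (marginalY Q) (condMean Q U) ≤ K * fEntropy f (marginalX Q) U) :
    EntropyContracts f Q K := by
  intro U hU
  have hPX := marginalX_mem_stdSimplex hQ
  have hPY := marginalY_mem_stdSimplex hQ
  have hnn : ∀ a ∈ Finset.univ, 0 ≤ marginalX Q a * U a := fun a _ => mul_nonneg (hX a).le (hU a)
  rcases (Finset.sum_nonneg hnn).eq_or_lt with h0 | hpos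
  · have hU0 : U = fun _ => 0 := funext fun a =>
      (mul_eq_zero.1 ((Finset.sum_eq_zero_iff_of_nonneg hnn).1 h0.symm a
        (Finset.mem_univ a))).resolve_left (hX a).ne'
    have hc : condMean Q U = fun _ => 0 := by
      funext b
      simp [condMean, hU0]
    rw [hc, hU0]
    simp [fEntropy, ← Finset.sum_mul, hPX.2, hPY.2]
  · obtain ⟨κ, hκ⟩ := hhom
    set c := ∑ a, marginalX Q a * U a with hc
    obtain ⟨hκ0, hκc⟩ := hκ c hpos
    have hV : ∀ a, 0 ≤ c⁻¹ * U a := fun a => mul_nonneg (inv_nonneg.2 hpos.le) (hU a)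
    have hV1 : ∑ a, marginalX Q a * (c⁻¹ * U a) = 1 := by
      simp only [mul_left_comm _ c⁻¹]
      rw [← Finset.mul_sum, ← hc, inv_mul_cancel₀ hpos.ne']
    have hUV : U = fun a => c * (c⁻¹ * U a) :=
      funext fun a => (mul_inv_cancel_left₀ hpos.ne' _).symm
    have hcU : condMean Q U = fun b => c * condMean Q (fun a => c⁻¹ * U a) b := by
      funext b
      rw [← condMean_const_mul, ← hUV]
    have eX := fEntropy_const_mul_of_fin hκc hPX hV
    rw [← hUV] at eX
    rw [hcU, fEntropy_const_mul_of_fin hκc hPY (condMean_nonneg hQ hV), eX, mul_left_comm]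
    exact mul_le_mul_of_nonneg_left (h _ hV hV1) hκ0

/-- A `χ²` contraction bound for `n + 1` independent copies yields one for a single pair. -/
theorem fEntropy_chiSqFun_condMean_le {A B : Type*} [Fintype A] [Fintype B] {Q : A × B → ℝ}
    (hQ : Q ∈ stdSimplex ℝ (A × B)) (hX : ∀ a, 0 < marginalX Q a) (hY : ∀ b, 0 < marginalY Q b)
    {n : ℕ} (hne : ¬((∃ x, marginalX (iidJoint Q (n + 1)) x = 1) ∨
      ∃ y, marginalY (iidJoint Q (n + 1)) y = 1)) {K : ℝ}
    (hK : eta chiSqFun (iidJoint Q (n + 1)) ≤ (K : EReal)) {U : A → ℝ} (hU : ∀ a, 0 ≤ U a)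
    (hU1 : ∑ a, marginalX Q a * U a = 1) :
    fEntropy chiSqFun (marginalY Q) (condMean Q U) ≤ K * fEntropy chiSqFun (marginalX Q) U := by
  have hPX := marginalX_mem_stdSimplex hQ
  have hchi := fEntropy_chiSqFun hPX hU1
  have hnn : ∀ a ∈ Finset.univ, 0 ≤ marginalX Q a * (U a - 1) ^ 2 :=
    fun a _ => mul_nonneg (hX a).le (sq_nonneg _)
  rcases (hchi.symm ▸ Finset.sum_nonneg hnn : 0 ≤ fEntropy chiSqFun (marginalX Q) U).eq_or_lt
    with h0 | hpos
  -- Zero `χ²`-entropy is excluded from the supremum; it forces `U = 1`, where both sides are 0.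
  · have hUone : U = fun _ => 1 := by
      funext a
      have h1 := (Finset.sum_eq_zero_iff_of_nonneg hnn).1 (hchi.symm.trans h0.symm) a
        (Finset.mem_univ a)
      have h2 := pow_eq_zero_iff two_ne_zero |>.1 ((mul_eq_zero.1 h1).resolve_left (hX a).ne')
      linarith
    have hc : condMean Q U = fun _ => 1 := by
      funext b
      rw [hUone, condMean_const (hY b)]
    rw [← h0, hc]
    simp [fEntropy, chiSqFun, (marginalY_mem_stdSimplex hQ).2]
  · have eX : fEntropy chiSqFun (marginalX (iidJoint Q (n + 1))) (fun x => U (x 0)) =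
        fEntropy chiSqFun (marginalX Q) U := by
      rw [funext (marginalX_iidJoint Q (n + 1)), fEntropy_iidJoint_apply_zero _ hPX]
    have eY : fEntropy chiSqFun (marginalY (iidJoint Q (n + 1)))
        (condMean (iidJoint Q (n + 1)) fun x => U (x 0)) =
        fEntropy chiSqFun (marginalY Q) (condMean Q U) := by
      rw [funext (marginalY_iidJoint Q (n + 1)), funext (condMean_iidJoint_apply_zero hY n U),
        fEntropy_iidJoint_apply_zero _ (marginalY_mem_stdSimplex hQ)]
    have hm : ∑ x, marginalX (iidJoint Q (n + 1)) x * U (x 0) = 1 := by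
      rw [← hU1, funext (marginalX_iidJoint Q (n + 1)), sum_prod_mul_apply_zero hPX.2]
    have h := (le_eta (by simp [chiSqFun])
      (fun x => (marginalX_iidJoint Q (n + 1) x).symm ▸ Finset.prod_pos fun i _ => hX _)
      (fun y => (marginalY_iidJoint Q (n + 1) y).symm ▸ Finset.prod_pos fun i _ => hY _)
      hne (fun x => hU (x 0)) hm (eX.symm ▸ hpos)).trans hK
    rw [eX, eY, EReal.coe_le_coe_iff, div_le_iff₀ hpos] at h
    exact h

theorem corollary3 {X Y : Type*} [Fintype X] [Fintype Y]
    (Q : X × Y → ℝ) (hQ : Q ∈ stdSimplex ℝ (X × Y))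
    (hX : ∀ x, 0 < marginalX Q x) (hY : ∀ y, 0 < marginalY Q y)
    (f : ℝ → ℝ)
    (hf0 : Tendsto f (𝓝[>] 0) (𝓝 (f 0)))
    (hconv : ConvexOn ℝ (Ioi 0) f)
    (hstrict : StrictConvexAtOne f)
    (hdiff : ThriceDifferentiableAtOne f)
    (hf1 : f 1 = 0)
    (hf2 : 0 < deriv (deriv f) 1)
    (hpinsker : ∀ t : ℝ, 0 < t →
      (f t - deriv f 1 * (t - 1)) *
          (1 - deriv (deriv (deriv f)) 1 / (3 * deriv (deriv f) 1) * (t - 1)) ≥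
        deriv (deriv f) 1 / 2 * (t - 1) ^ 2)
    (hg : ConcaveOn ℝ (Ioi 0) (fun x => (f x - f 0) / x))
    (hsub : SubadditiveEntropy f)
    (hhom : HomogeneousEntropy f)
    (n : ℕ) :
    eta chiSqFun (iidJoint Q n) ≤ eta f (iidJoint Q n) ∧
    eta f (iidJoint Q n) ≤
      (((deriv f 1 + f 0) / (deriv (deriv f) 1 * ⨅ x, marginalX Q x) : ℝ) : EReal) *
        eta chiSqFun (iidJoint Q n) := by
  have hd := hdiff.1.self_of_nhds
  have hQn := iidJoint_mem_stdSimplex hQ n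
  have hXn : ∀ x, 0 < marginalX (iidJoint Q n) x := fun x =>
    (marginalX_iidJoint Q n x).symm ▸ Finset.prod_pos fun i _ => hX _
  have hYn : ∀ y, 0 < marginalY (iidJoint Q n) y := fun y =>
    (marginalY_iidJoint Q n y).symm ▸ Finset.prod_pos fun i _ => hY _
  refine ⟨eta_chiSqFun_le_eta hdiff.1 hdiff.2.1.self_of_nhds hf1 hf2 hQn hXn hYn, ?_⟩
  by_cases hne : (∃ x, marginalX (iidJoint Q n) x = 1) ∨ ∃ y, marginalY (iidJoint Q n) y = 1
  · rw [eta_eq_zero _ hXn hne, eta_eq_zero _ hXn hne, mul_zero]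
  obtain _ | n := n
  -- For `n = 0` the input is constant, a case settled by the convention.
  · exact absurd (Or.inl ⟨Fin.elim0, by simp [marginalX_iidJoint]⟩) hne
  have hPX := marginalX_mem_stdSimplex hQ
  have : Nonempty X := by
    by_contra h
    rw [not_nonempty_iff] at h
    simpa using hPX.2
  set m := ⨅ x, marginalX Q x with hm
  have hm0 : 0 < m := by
    obtain ⟨x, hx⟩ := exists_eq_ciInf_of_finite (f := marginalX Q)
    exact hm ▸ hx ▸ hX x
  have hmle : ∀ x, m ≤ marginalX Q x := fun x => ciInf_le (Set.finite_range _).bddBelow x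
  have hnn : ∀ t : ℝ, 0 ≤ t → 0 ≤ f t - deriv f 1 * (t - 1) :=
    fun t => sub_deriv_mul_nonneg hf0 hconv hd hf1
  have hquad := fun t : ℝ => quadratic_le_of_nonneg (t := t) hf0 hpinsker
  have hs : 0 < deriv f 1 + f 0 := by
    have h0 := hnn 0 le_rfl
    have h1 := hquad 0 le_rfl
    -- If `f'(1) + f(0)` were 0, condition (ii) extended to `t = 0` would read `f''(1)/2 ≤ 0`.
    refine lt_of_le_of_ne (by linarith) fun h => ?_
    have h2 : f 0 - deriv f 1 * (0 - 1) = 0 := by linarith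
    rw [h2] at h1
    linarith
  set c := (deriv f 1 + f 0) / (deriv (deriv f) 1 * m) with hc
  have hc0 : 0 < c := div_pos hs (mul_pos hf2 hm0)
  refine eta_le hf1 hXn hYn hne fun U hU hU1 hpos => ?_
  have hchi : 0 < fEntropy chiSqFun (marginalX (iidJoint Q (n + 1))) U :=
    (pos_iff_pos_of_mul_pos (hpos.trans_le
      (fEntropy_le_chiSq hd hf1 hg (marginalX_mem_stdSimplex hQn) hU hU1))).1 hs
  have hge := le_eta (f := chiSqFun) (by simp [chiSqFun]) hXn hYn hne hU hU1 hchi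
  have hratio : 0 ≤ fEntropy chiSqFun (marginalY (iidJoint Q (n + 1)))
      (condMean (iidJoint Q (n + 1)) U) /
        fEntropy chiSqFun (marginalX (iidJoint Q (n + 1))) U := by
    refine div_nonneg ?_ hchi.le
    rw [fEntropy_chiSqFun (marginalY_mem_stdSimplex hQn)
      ((sum_marginalY_mul_condMean hYn U).trans hU1)]
    exact Finset.sum_nonneg fun y _ => mul_nonneg (hYn y).le (sq_nonneg _)
  have heta0 : 0 ≤ eta chiSqFun (iidJoint Q (n + 1)) :=
    (EReal.coe_nonneg.2 hratio).trans hge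
  -- The coefficient is an extended real: nonnegativity excludes `⊥`, and at `⊤` the bound is
  -- trivial since `c > 0`.
  induction heta : eta chiSqFun (iidJoint Q (n + 1)) with
  | bot => simp [heta] at heta0
  | top => rw [EReal.coe_mul_top_of_pos hc0]; exact le_top
  | coe K =>
    have hK : 0 ≤ K := EReal.coe_nonneg.1 (heta ▸ heta0)
    -- The sandwich is used for a single pair, so `m` is the minimum of the one-letter marginal.
    have hone : EntropyContracts f Q (c * K) := by
      refine EntropyContracts.of_mean_one hhom hQ hX fun V hV hV1 => ?_
      have h1 := fEntropy_le_chiSq hd hf1 hg (marginalY_mem_stdSimplex hQ)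
        (condMean_nonneg hQ hV) ((sum_marginalY_mul_condMean hY V).trans hV1)
      have h2 := fEntropy_chiSqFun_condMean_le hQ hX hY hne heta.le hV hV1
      have h3 := chiSq_le_fEntropy hf1 (half_pos hf2) hnn hquad hmle hPX hV hV1
      rw [mul_div_cancel₀ _ (two_ne_zero' ℝ), ← le_div_iff₀' (mul_pos hf2 hm0)] at h3
      calc fEntropy f (marginalY Q) (condMean Q V)
          ≤ (deriv f 1 + f 0) * (K * fEntropy chiSqFun (marginalX Q) V) :=
            h1.trans (mul_le_mul_of_nonneg_left h2 hs.le)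
        _ ≤ (deriv f 1 + f 0) * (K * (fEntropy f (marginalX Q) V / (deriv (deriv f) 1 * m))) :=
            mul_le_mul_of_nonneg_left (mul_le_mul_of_nonneg_left h3 hK) hs.le
        _ = c * K * fEntropy f (marginalX Q) V := by rw [hc]; ring
    have hn := hone.iidJoint hsub hQ hY (mul_nonneg hc0.le hK) (n + 1) U hU
    rw [← EReal.coe_mul, EReal.coe_le_coe_iff, div_le_iff₀ hpos]
    exact hn
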